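/- Let $d \ge 1$ be an integer and $\eta > 0$. Let $G$ be a random $d\times d$ matrix with independent $\mathcal N(0,1)$ entries, and let $\mathbb S^d_{>0}$ be the set of real symmetric positive definite $d\times d$ matrices. For $\Sigma_1,\Sigma_2\in\mathbb S^d_{>0}$ put $$\mathrm{dist}(\Sigma_1,\Sigma_2)=\max\{\|\Sigma_1^{-1/2}\Sigma_2\Sigma_1^{-1/2}-I\|,\ \|\Sigma_2^{-1/2}\Sigma_1\Sigma_2^{-1/2}-I\|\},$$ where $\|\cdot\|$ is the spectral norm, and for $\Sigma\in\mathbb S^d_{>0}$ put $$\mathcal B(\Sigma)=\Sigma^{1/2}(I+\eta G)(I+\eta G)^\top\Sigma^{1/2}.$$ Two random variables $X, Y$ are called $(\varepsilon,\delta)$-indistinguishable if $\Pr[X\in S]\le e^{\varepsilon}\Pr[Y\in S]+\delta$ and $\Pr[Y\in S]\le e^{\varepsilon}\Pr[X\in S]+\delta$ for every measurable set $S$. A randomized map $\mathcal B$ from $\mathbb S^d_{>0}$ to itself (that is, $\mathcal B(\Sigma)\in\mathbb S^d_{>0}$ almost surely for each $\Sigma$) is called a $(\gamma,\varepsilon,\delta)$-masking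 mechanism if $\mathcal B(\Sigma_1)$ and $\mathcal B(\Sigma_2)$ are $(\varepsilon,\delta)$-indistinguishable whenever $\mathrm{dist}(\Sigma_1,\Sigma_2)\le\gamma$. 1. Let $\Sigma_1,\Sigma_2\in\mathbb S^d_{>0}$ satisfy $\mathrm{dist}(\Sigma_1,\Sigma_2)\le\gamma\le 1/2$. Then for every $\delta_0>0$, the random matrices $\Sigma_1^{1/2}(I+\eta G)$ and $\Sigma_2^{1/2}(I+\eta G)$ are $(\varepsilon_0(\delta_0),\delta_0)$-indistinguishable, and so are $\mathcal B(\Sigma_1)$ and $\mathcal B(\Sigma_2)$, where $$\varepsilon_0(\delta_0)=\frac{\gamma^2 d}{2}\Bigl(d+\frac1{\eta^2}\Bigr)+2d\gamma\sqrt{\ln(2/\delta_0)}+2\gamma\ln(2/\delta_0)+\frac{3\gamma\sqrt d\,\sqrt{\ln(2/\delta_0)}}{\eta}$$ (with the convention $\sqrt{x}=0$ for $x<0$, which matters only in the trivial case $\delta_0>2$). 2. For all $\varepsilon,\delta\in(0,1]$, the map $\mathcal B$ is a $(\gamma,\varepsilon,\delta)$-masking mechanism, where $$\gamma=\min\left\{\sqrt{\frac{\varepsilon}{2d(d+1/\eta^2)}},\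 \frac{\varepsilon}{8d\sqrt{\ln(2/\delta)}},\ \frac{\varepsilon}{8\ln(2/\delta)},\ \frac{\varepsilon\eta}{12\sqrt d\,\sqrt{\ln(2/\delta)}}\right\}.$$ -/

import Mathlib

open MeasureTheory ProbabilityTheory Matrix
open scoped ENNReal MatrixOrder Matrix.Norms.L2Operator

noncomputable section

namespace CovMask

/-- Matrices carry the product σ-algebra of their entries (equivalently, the Borel σ-algebra). -/
instance instMeasurableSpaceMatrix (d : ℕ) : MeasurableSpace (Matrix (Fin d) (Fin d) ℝ) :=
  inferInstanceAs (MeasurableSpace (Fin d → Fin d → ℝ))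

/-- Two distributions are `(ε, δ)`-indistinguishable if `μ S ≤ e^ε ν S + δ` and
`ν S ≤ e^ε μ S + δ` for every measurable set `S`. -/
def Indistinguishable {Z : Type*} [MeasurableSpace Z] (μ ν : Measure Z) (ε δ : ℝ) : Prop :=
  ∀ S : Set Z, MeasurableSet S →
    μ S ≤ ENNReal.ofReal (Real.exp ε) * ν S + ENNReal.ofReal δ ∧
    ν S ≤ ENNReal.ofReal (Real.exp ε) * μ S + ENNReal.ofReal δ

/-- A randomized map of `Y ⊆ Z` to itself, given by the law `B y` of its output at `y ∈ Y`, is a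
`(γ, ε, δ)`-masking mechanism for `(Y, dist)` if its outputs at any two points of `Y` at
distance at most `γ` are `(ε, δ)`-indistinguishable. -/
def IsMaskingMechanism {Z : Type*} [MeasurableSpace Z] (Y : Set Z) (dist : Z → Z → ℝ)
    (B : Z → Measure Z) (γ ε δ : ℝ) : Prop :=
  (∀ y ∈ Y, IsProbabilityMeasure (B y) ∧ ∀ᵐ z ∂(B y), z ∈ Y) ∧
  ∀ y₁ ∈ Y, ∀ y₂ ∈ Y, dist y₁ y₂ ≤ γ → Indistinguishable (B y₁) (B y₂) ε δ

variable {d : ℕ}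

/-- The spectral distance
`max (‖A^{-1/2} B A^{-1/2} - I‖) (‖B^{-1/2} A B^{-1/2} - I‖)` of positive definite matrices,
in the `ℓ²` operator norm. -/
def specDist (A B : Matrix (Fin d) (Fin d) ℝ) : ℝ :=
  max ‖(CFC.sqrt A)⁻¹ * B * (CFC.sqrt A)⁻¹ - 1‖ ‖(CFC.sqrt B)⁻¹ * A * (CFC.sqrt B)⁻¹ - 1‖

/-- The law of a `d × d` matrix with independent `N(0, 1)` entries. -/
def gaussianMatrix (d : ℕ) : Measure (Matrix (Fin d) (Fin d) ℝ) :=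
  (Measure.pi fun _ : Fin d × Fin d => gaussianReal 0 1).map fun g => Matrix.of fun i j => g (i, j)

/-- The law of `Σ^{1/2} (I + η G)`. -/
def noisyFactor (η : ℝ) (A : Matrix (Fin d) (Fin d) ℝ) : Measure (Matrix (Fin d) (Fin d) ℝ) :=
  (gaussianMatrix d).map fun G => CFC.sqrt A * (1 + η • G)

/-- The law of `Σ^{1/2} (I + η G) (I + η G)ᵀ Σ^{1/2}`. -/
def covMechanism (η : ℝ) (A : Matrix (Fin d) (Fin d) ℝ) : Measure (Matrix (Fin d) (Fin d) ℝ) :=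
  (gaussianMatrix d).map fun G => CFC.sqrt A * (1 + η • G) * (1 + η • G)ᵀ * CFC.sqrt A

/-- The privacy parameter `ε₀(δ₀)`. -/
def epsZero (d : ℕ) (η γ δ₀ : ℝ) : ℝ :=
  γ ^ 2 * d / 2 * (d + 1 / η ^ 2) + 2 * d * γ * √(Real.log (2 / δ₀)) + 2 * γ * Real.log (2 / δ₀)
    + 3 * γ * √d * √(Real.log (2 / δ₀)) / η

/-- The masking radius of the mechanism for privacy parameters `ε, δ`. -/
def maskRadius (d : ℕ) (η ε δ : ℝ) : ℝ :=
  min (min √(ε / (2 * d * (d + 1 / η ^ 2))) (ε / (8 * d * √(Real.log (2 / δ)))))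
    (min (ε / (8 * Real.log (2 / δ))) (ε * η / (12 * √d * √(Real.log (2 / δ)))))

end CovMask

end

/-!
With `P = A₂^{-1/2} A₁^{1/2}` one has `A₁^{1/2} (I + η G) = A₂^{1/2} (I + η G')`, where
`G' = P G + η⁻¹ (P - I)`. It therefore suffices to compare a standard Gaussian vector `g` with its
affine image `M g + k`, where `M = P ⊗ I` and `k` is the vectorized shift. The logarithm of their
likelihood ratio, the privacy loss, is a quadratic polynomial in `g`, which the eigenvectors of
`Mᵀ M` diagonalize without changing the law of `g`. Its Laplace transform is then a product of
one-dimensional Gaussian integrals, and Chernoff's bound controls its tail.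

The spectral distance puts the spectrum of `Pᵀ P` within `γ ≤ 1 / 2` of `1`. To bound the shift,
expand `‖P - I‖_F² = tr Pᵀ P - 2 tr P + d`: since `P` is similar to a positive definite matrix,
`tr P ≥ d + log det P`, and what remains is `∑ (t - 1 - log t) ≤ d γ²` over the eigenvalues `t` of
`Pᵀ P`. Finally `B(A) = Z Zᵀ` is a post-processing of the noisy factor `Z = A^{1/2} (I + η G)`.
-/

namespace CovMask

open scoped Kronecker

section PrivacyLoss

lemma map_withDensity_comp {α β : Type*} [MeasurableSpace α] [MeasurableSpace β] (μ : Measure α)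
    {f : α → β} {φ : β → ℝ≥0∞} (hf : Measurable f) (hφ : Measurable φ) :
    (μ.withDensity (φ ∘ f)).map f = (μ.map f).withDensity φ := by
  ext s hs
  rw [Measure.map_apply hf hs, withDensity_apply _ (hf hs), withDensity_apply _ hs,
    setLIntegral_map hs hφ hf]
  rfl

lemma measure_le_withDensity_exp_neg_add {α : Type*} [MeasurableSpace α] (μ : Measure α)
    {L : α → ℝ} (hL : Measurable L) (ε : ℝ) {S : Set α} (hS : MeasurableSet S) :
    μ S ≤ ENNReal.ofReal (Real.exp ε) *
        μ.withDensity (fun g => ENNReal.ofReal (Real.exp (-L g))) S + μ {g | ε < L g} := by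
  have hdensity : Measurable fun g => ENNReal.ofReal (Real.exp (-L g)) := hL.neg.exp.ennreal_ofReal
  have hone_le : ∀ g ∈ S \ {g | ε < L g},
      1 ≤ ENNReal.ofReal (Real.exp ε) * ENNReal.ofReal (Real.exp (-L g)) := fun g hg => by
    rw [← ENNReal.ofReal_mul (Real.exp_pos _).le, ← Real.exp_add, ENNReal.one_le_ofReal,
      Real.one_le_exp_iff]
    have : L g ≤ ε := not_lt.1 hg.2
    linarith
  have hdiff : μ (S \ {g | ε < L g}) ≤ ENNReal.ofReal (Real.exp ε) *
      μ.withDensity (fun g => ENNReal.ofReal (Real.exp (-L g))) S := calc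
    μ (S \ {g | ε < L g})
      ≤ ∫⁻ g in S \ {g | ε < L g},
          ENNReal.ofReal (Real.exp ε) * ENNReal.ofReal (Real.exp (-L g)) ∂μ := by
        rw [← setLIntegral_one]
        exact setLIntegral_mono (hdensity.const_mul _) hone_le
    _ ≤ ∫⁻ g in S, ENNReal.ofReal (Real.exp ε) * ENNReal.ofReal (Real.exp (-L g)) ∂μ :=
        lintegral_mono_set Set.sdiff_subset
    _ = _ := by rw [lintegral_const_mul _ hdensity, withDensity_apply _ hS]
  calc μ S ≤ μ (S \ {g | ε < L g}) + μ {g | ε < L g} := tsub_le_iff_right.1 le_measure_sdiff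
    _ ≤ _ := by gcongr

variable {ι : Type*} [Fintype ι]

/-- The law of a family of independent `N(0, 1)` variables indexed by `ι`. It serves the Gaussian
matrix, whose entries are indexed by pairs. -/
noncomputable def stdGaussianPi (ι : Type*) [Fintype ι] : Measure (ι → ℝ) :=
  Measure.pi fun _ => gaussianReal 0 1

instance : IsProbabilityMeasure (stdGaussianPi ι) := by
  unfold stdGaussianPi
  infer_instance

/-- The Lebesgue density of `stdGaussianPi`. -/
noncomputable def stdGaussianPiPDFReal (g : ι → ℝ) : ℝ :=
  ∏ i, gaussianPDFReal 0 1 (g i)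

lemma stdGaussianPiPDFReal_pos (g : ι → ℝ) : 0 < stdGaussianPiPDFReal g :=
  Finset.prod_pos fun _ _ => gaussianPDFReal_pos _ _ _ one_ne_zero

lemma measurable_stdGaussianPiPDFReal : Measurable (stdGaussianPiPDFReal : (ι → ℝ) → ℝ) :=
  Finset.measurable_prod _ fun i _ =>
    (measurable_gaussianPDFReal 0 1).comp (measurable_pi_apply i)

lemma stdGaussianPiPDFReal_eq (g : ι → ℝ) :
    stdGaussianPiPDFReal g
      = (√(2 * Real.pi))⁻¹ ^ Fintype.card ι * Real.exp (-(g ⬝ᵥ g) / 2) := by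
  simp only [stdGaussianPiPDFReal, gaussianPDFReal, Finset.prod_mul_distrib, ← Real.exp_sum,
    NNReal.coe_one, mul_one, sub_zero, Finset.prod_const, Finset.card_univ, dotProduct,
    ← Finset.sum_div, Finset.sum_neg_distrib, sq]

lemma stdGaussianPi_eq_withDensity :
    stdGaussianPi ι = volume.withDensity fun g => ENNReal.ofReal (stdGaussianPiPDFReal g) := by
  refine Measure.pi_eq fun s hs => ?_
  have hint : Integrable (stdGaussianPiPDFReal : (ι → ℝ) → ℝ)
      (Measure.pi fun i => volume.restrict (s i)) :=
    Integrable.fintype_prod fun i => (integrable_gaussianPDFReal 0 1).restrict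
  rw [withDensity_apply _ (MeasurableSet.univ_pi hs), volume_pi, Measure.restrict_pi_pi,
    ← ofReal_integral_eq_lintegral_ofReal hint
      (.of_forall fun g => (stdGaussianPiPDFReal_pos g).le)]
  simp only [stdGaussianPiPDFReal]
  rw [integral_fintype_prod_eq_prod, ENNReal.ofReal_prod_of_nonneg fun i _ =>
    integral_nonneg (gaussianPDFReal_nonneg 0 1)]
  simp only [gaussianReal_apply_eq_integral 0 one_ne_zero]

lemma stdGaussianPi_absolutelyContinuous : stdGaussianPi ι ≪ volume := by
  rw [stdGaussianPi_eq_withDensity]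
  exact withDensity_absolutelyContinuous _ _

lemma mulVec_dotProduct_mulVec (M : Matrix ι ι ℝ) (g h : ι → ℝ) :
    (M *ᵥ g) ⬝ᵥ (M *ᵥ h) = g ⬝ᵥ ((Mᵀ * M) *ᵥ h) := by
  rw [← mulVec_mulVec, dotProduct_mulVec g, vecMul_transpose]

lemma continuous_mulVec_add (M : Matrix ι ι ℝ) (k : ι → ℝ) :
    Continuous fun g : ι → ℝ => M *ᵥ g + k :=
  (continuous_const.matrix_mulVec continuous_id).add continuous_const

variable [DecidableEq ι]

/-- The privacy loss of the affine map `g ↦ M g + k`: the logarithm of the likelihood ratio, at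
`M g + k`, of the image of `stdGaussianPi` under this map and `stdGaussianPi` itself. -/
noncomputable def privacyLoss (M : Matrix ι ι ℝ) (k g : ι → ℝ) : ℝ :=
  -Real.log |M.det| + ((M *ᵥ g + k) ⬝ᵥ (M *ᵥ g + k) - g ⬝ᵥ g) / 2

lemma measurable_privacyLoss (M : Matrix ι ι ℝ) (k : ι → ℝ) : Measurable (privacyLoss M k) := by
  have haff := continuous_mulVec_add M k
  exact (continuous_const.add (((haff.dotProduct haff).sub
    (continuous_id.dotProduct continuous_id)).div_const 2)).measurable

lemma abs_det_mul_stdGaussianPiPDFReal {M : Matrix ι ι ℝ} (hM : M.det ≠ 0) (k g : ι → ℝ) :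
    |M.det| * stdGaussianPiPDFReal (M *ᵥ g + k)
      = stdGaussianPiPDFReal g * Real.exp (-privacyLoss M k g) := by
  rw [stdGaussianPiPDFReal_eq, stdGaussianPiPDFReal_eq, privacyLoss, mul_assoc, ← Real.exp_add]
  conv_lhs => rw [← Real.exp_log (abs_pos.2 hM)]
  rw [mul_left_comm, ← Real.exp_add]
  congr 2
  ring

lemma volume_eq_smul_map_mulVec_add {M : Matrix ι ι ℝ} (hM : M.det ≠ 0) (k : ι → ℝ) :
    (volume : Measure (ι → ℝ))
      = ENNReal.ofReal |M.det| • volume.map (fun g : ι → ℝ => M *ᵥ g + k) := by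
  have hlin : Measurable (toLin' M) := (toLin' M).continuous_of_finiteDimensional.measurable
  have hmap : volume.map (fun g : ι → ℝ => M *ᵥ g + k) = (volume.map (toLin' M)).map (· + k) := by
    rw [Measure.map_map (measurable_add_const k) hlin]
    rfl
  rw [hmap, Real.map_matrix_volume_pi_eq_smul_volume_pi hM, Measure.map_smul,
    map_add_right_eq_self, smul_smul, ← ENNReal.ofReal_mul (abs_nonneg _), ← abs_mul,
    mul_inv_cancel₀ hM, abs_one, ENNReal.ofReal_one, one_smul]

theorem map_mulVec_add_withDensity_privacyLoss {M : Matrix ι ι ℝ} (hM : M.det ≠ 0) (k : ι → ℝ) :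
    ((stdGaussianPi ι).withDensity fun g => ENNReal.ofReal (Real.exp (-privacyLoss M k g))).map
      (fun g => M *ᵥ g + k) = stdGaussianPi ι := by
  have haff : Measurable fun g : ι → ℝ => M *ᵥ g + k := (continuous_mulVec_add M k).measurable
  have hpdf : Measurable fun g : ι → ℝ => ENNReal.ofReal (stdGaussianPiPDFReal g) :=
    measurable_stdGaussianPiPDFReal.ennreal_ofReal
  have hdensity : (fun g => ENNReal.ofReal (stdGaussianPiPDFReal g)) *
        (fun g => ENNReal.ofReal (Real.exp (-privacyLoss M k g)))
      = ENNReal.ofReal |M.det| •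
        ((fun g => ENNReal.ofReal (stdGaussianPiPDFReal g)) ∘ fun g => M *ᵥ g + k) := by
    ext g
    simp only [Pi.mul_apply, Pi.smul_apply, smul_eq_mul, Function.comp_apply]
    rw [← ENNReal.ofReal_mul (stdGaussianPiPDFReal_pos g).le,
      ← abs_det_mul_stdGaussianPiPDFReal hM, ENNReal.ofReal_mul (abs_nonneg _)]
  have hloss : Measurable fun g => ENNReal.ofReal (Real.exp (-privacyLoss M k g)) :=
    (measurable_privacyLoss M k).neg.exp.ennreal_ofReal
  rw [stdGaussianPi_eq_withDensity, ← withDensity_mul _ hpdf hloss, hdensity,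
    withDensity_smul _ (hpdf.comp haff), Measure.map_smul, map_withDensity_comp _ haff hpdf,
    ← withDensity_smul_measure, ← volume_eq_smul_map_mulVec_add hM]

lemma measurePreserving_mulVec_orthogonalGroup {U : Matrix ι ι ℝ}
    (hU : U ∈ orthogonalGroup ι ℝ) :
    MeasurePreserving (fun g : ι → ℝ => U *ᵥ g) (stdGaussianPi ι) (stdGaussianPi ι) := by
  have hUU : Uᵀ * U = 1 := (mem_orthogonalGroup_iff' ι ℝ).1 hU
  have hdet : U.det * U.det = 1 := by simpa using congrArg det hUU
  have h0 : U.det ≠ 0 := left_ne_zero_of_mul_eq_one hdet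
  have hloss : privacyLoss U 0 = 0 := by
    ext g
    simp [privacyLoss, mulVec_dotProduct_mulVec, hUU, abs_eq_abs.2 (mul_self_eq_one_iff.1 hdet)]
  have := map_mulVec_add_withDensity_privacyLoss h0 0
  simp only [hloss, add_zero, Pi.zero_apply, neg_zero, Real.exp_zero, ENNReal.ofReal_one] at this
  refine ⟨(continuous_const.matrix_mulVec continuous_id).measurable, ?_⟩
  rwa [show (fun _ : ι → ℝ => (1 : ℝ≥0∞)) = 1 from rfl, withDensity_one] at this

lemma map_mulVec_add_stdGaussianPi_le_exp_mul_add {M : Matrix ι ι ℝ} (hM : M.det ≠ 0)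
    (k : ι → ℝ) (ε : ℝ) {S : Set (ι → ℝ)} (hS : MeasurableSet S) :
    (stdGaussianPi ι).map (fun g => M *ᵥ g + k) S
      ≤ ENNReal.ofReal (Real.exp ε) * stdGaussianPi ι S
        + stdGaussianPi ι {g | ε < privacyLoss M k g} := by
  have haff : Measurable fun g : ι → ℝ => M *ᵥ g + k := (continuous_mulVec_add M k).measurable
  have := measure_le_withDensity_exp_neg_add (stdGaussianPi ι) (measurable_privacyLoss M k) ε
    (haff hS)
  rwa [← Measure.map_apply haff hS, ← Measure.map_apply haff hS,
    map_mulVec_add_withDensity_privacyLoss hM] at this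

end PrivacyLoss

section GaussianIntegrals

lemma neg_log_one_sub_le {a : ℝ} (ha : |a| ≤ 1 / 2) : -Real.log (1 - a) ≤ a + a ^ 2 := by
  -- Four terms of the Taylor expansion are the fewest whose remainder estimate is sharp enough.
  have htaylor := (abs_le.1 (Real.abs_log_sub_add_sum_range_le (by linarith : |a| < 1) 4)).1
  simp only [Finset.sum_range_succ, Finset.sum_range_zero] at htaylor
  norm_num at htaylor
  have hrem : |a| ^ 5 / (1 - |a|) ≤ a ^ 2 / 4 := by
    rw [div_le_iff₀ (by linarith), ← sq_abs]
    nlinarith [pow_le_pow_left₀ (abs_nonneg a) ha 3, sq_nonneg |a|]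
  have hcubic : a ^ 3 ≤ a ^ 2 / 2 := by nlinarith [le_of_abs_le ha, sq_nonneg a]
  have hquartic : a ^ 4 ≤ a ^ 2 / 4 := by
    nlinarith [sq_le_sq' (by linarith [neg_le_of_abs_le ha]) (le_of_abs_le ha), sq_nonneg a]
  linarith [sq_nonneg a]

lemma sub_one_sub_log_le {t : ℝ} (ht : |t - 1| ≤ 1 / 2) :
    t - 1 - Real.log t ≤ (t - 1) ^ 2 := by
  have := neg_log_one_sub_le (a := 1 - t) (by rwa [abs_sub_comm])
  rw [sub_sub_cancel] at this
  linarith [sq_nonneg (t - 1), sub_sq_comm 1 t]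

lemma gaussianPDFReal_mul_exp_quadratic {a : ℝ} (ha : a < 1) (b x : ℝ) :
    gaussianPDFReal 0 1 x * Real.exp (a * x ^ 2 / 2 + b * x)
      = Real.exp ((b ^ 2 / (1 - a) - Real.log (1 - a)) / 2)
        * gaussianPDFReal (b / (1 - a)) (1 - a)⁻¹.toNNReal x := by
  have hpos : 0 < 1 - a := sub_pos.2 ha
  have hnormalization : (√(2 * Real.pi * (1 - a)⁻¹))⁻¹
      = (√(2 * Real.pi))⁻¹ * Real.exp (Real.log (1 - a) / 2) := by
    rw [Real.sqrt_mul (by positivity), mul_inv, Real.sqrt_inv, inv_inv, Real.exp_half,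
      Real.exp_log hpos]
  rw [gaussianPDFReal, gaussianPDFReal, Real.coe_toNNReal _ (inv_pos.2 hpos).le, hnormalization,
    NNReal.coe_one, mul_one, mul_assoc, mul_assoc, ← Real.exp_add, ← Real.exp_add,
    mul_left_comm, ← Real.exp_add]
  congr 2
  field_simp
  ring

lemma lintegral_exp_quadratic_gaussianReal {a : ℝ} (ha : a < 1) (b : ℝ) :
    ∫⁻ x, ENNReal.ofReal (Real.exp (a * x ^ 2 / 2 + b * x)) ∂(gaussianReal 0 1)
      = ENNReal.ofReal (Real.exp ((b ^ 2 / (1 - a) - Real.log (1 - a)) / 2)) := by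
  have hvar : (1 - a)⁻¹.toNNReal ≠ 0 := by simpa using ha
  rw [gaussianReal_of_var_ne_zero 0 one_ne_zero,
    lintegral_withDensity_eq_lintegral_mul _ (measurable_gaussianPDF 0 1) (by fun_prop)]
  simp only [Pi.mul_apply, gaussianPDF, ← ENNReal.ofReal_mul (gaussianPDFReal_nonneg 0 1 _),
    gaussianPDFReal_mul_exp_quadratic ha, ENNReal.ofReal_mul (Real.exp_pos _).le]
  rw [lintegral_const_mul _ (measurable_gaussianPDFReal _ _).ennreal_ofReal,
    lintegral_gaussianPDFReal_eq_one _ hvar, mul_one]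

variable {ι : Type*} [Fintype ι]

lemma lintegral_exp_quadratic_stdGaussianPi_le {a b : ι → ℝ} (ha : ∀ i, |a i| ≤ 1 / 2) :
    ∫⁻ g, ENNReal.ofReal (Real.exp (∑ i, (a i * g i ^ 2 / 2 + b i * g i))) ∂(stdGaussianPi ι)
      ≤ ENNReal.ofReal (Real.exp (∑ i, (a i / 2 + a i ^ 2 / 2 + b i ^ 2))) := by
  set X : ι → ℝ → ℝ≥0∞ := fun i x => ENNReal.ofReal (Real.exp (a i * x ^ 2 / 2 + b i * x))
  have hX : ∀ i, Measurable (X i) := fun i => by fun_prop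
  have hindep : iIndepFun (fun i (g : ι → ℝ) => X i (g i)) (stdGaussianPi ι) :=
    iIndepFun_pi fun i => (hX i).aemeasurable
  have hfactor : ∀ i, ∫⁻ g, X i (g i) ∂(stdGaussianPi ι)
      ≤ ENNReal.ofReal (Real.exp (a i / 2 + a i ^ 2 / 2 + b i ^ 2)) := fun i => by
    have hle := le_of_abs_le (ha i)
    have hsq : b i ^ 2 / (1 - a i) ≤ 2 * b i ^ 2 := by
      rw [div_le_iff₀ (by linarith)]
      nlinarith [sq_nonneg (b i)]
    have heval : ∫⁻ g, X i (g i) ∂(stdGaussianPi ι) = ∫⁻ y, X i y ∂(gaussianReal 0 1) :=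
      (measurePreserving_eval (fun _ => gaussianReal 0 1) i).lintegral_comp (hX i)
    rw [heval, lintegral_exp_quadratic_gaussianReal (by linarith)]
    gcongr
    linarith [neg_log_one_sub_le (ha i)]
  simp only [Real.exp_sum, ENNReal.ofReal_prod_of_nonneg fun _ _ => (Real.exp_pos _).le]
  rw [lintegral_prod_eq_prod_lintegral_of_indepFun Finset.univ _ hindep
    fun i => (hX i).comp (measurable_pi_apply i)]
  exact Finset.prod_le_prod' fun i _ => hfactor i

end GaussianIntegrals

section Tail

-- The unconstrained minimizer `√(x / v)` of `l² v - 2 l √(x v)` may violate `l γ ≤ 1 / 2`; the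
-- endpoint `l = 1 / (2 γ)` then suffices.
lemma exists_chernoff_parameter {γ v x : ℝ} (hγ : 0 < γ) (hv : 0 ≤ v) (hx : 0 ≤ x) :
    ∃ l, 0 ≤ l ∧ l * γ ≤ 1 / 2 ∧ l ^ 2 * v + x ≤ l * (2 * √(x * v) + 2 * γ * x) := by
  obtain ⟨s, hs, rfl⟩ : ∃ s, 0 ≤ s ∧ s ^ 2 = x := ⟨√x, Real.sqrt_nonneg x, Real.sq_sqrt hx⟩
  obtain ⟨w, hw, rfl⟩ : ∃ w, 0 ≤ w ∧ w ^ 2 = v := ⟨√v, Real.sqrt_nonneg v, Real.sq_sqrt hv⟩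
  rw [← mul_pow, Real.sqrt_sq (mul_nonneg hs hw)]
  rcases le_or_gt (2 * γ * s) w with h | h
  · have hsw : s / w * w = s := div_mul_cancel_of_imp fun hw0 => by
      subst hw0
      nlinarith
    refine ⟨s / w, by positivity, ?_, ?_⟩
    · rw [div_mul_eq_mul_div]
      exact div_le_of_le_mul₀ hw (by norm_num) (by linarith)
    · have hnonneg : 0 ≤ s / w * (2 * γ * s ^ 2) := by positivity
      linear_combination hnonneg + (s / w * w - s) * hsw
  · have hl : 0 ≤ 1 / (2 * γ) := by positivity
    refine ⟨1 / (2 * γ), hl, le_of_eq (by field_simp), ?_⟩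
    have hlγ : 1 / (2 * γ) * (2 * γ) = 1 := by field_simp
    have hlw : 1 / (2 * γ) * w ≤ s := by
      rw [one_div_mul_eq_div, div_le_iff₀ (by positivity)]
      linarith
    nlinarith [mul_le_mul_of_nonneg_right hlw (mul_nonneg hl hw), mul_nonneg hs (mul_nonneg hl hw)]

theorem measure_lt_le_of_lintegral_exp_le {α : Type*} [MeasurableSpace α] (μ : Measure α)
    {L : α → ℝ} (hL : Measurable L) {γ m v x : ℝ} (hγ : 0 < γ) (hv : 0 ≤ v) (hx : 0 ≤ x)
    (hmgf : ∀ l, 0 ≤ l → l * γ ≤ 1 / 2 → ∫⁻ g, ENNReal.ofReal (Real.exp (l * L g)) ∂μ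
      ≤ ENNReal.ofReal (Real.exp (l * m + l ^ 2 * v))) :
    μ {g | m + 2 * √(x * v) + 2 * γ * x < L g} ≤ ENNReal.ofReal (Real.exp (-x)) := by
  obtain ⟨l, hl, hlγ, hlx⟩ := exists_chernoff_parameter hγ hv hx
  set ε := m + 2 * √(x * v) + 2 * γ * x with hε
  have hsub : {g | ε < L g} ⊆
      {g | ENNReal.ofReal (Real.exp (l * ε)) ≤ ENNReal.ofReal (Real.exp (l * L g))} := by
    intro g hg
    have : ε < L g := hg
    change ENNReal.ofReal _ ≤ _
    gcongr
  calc μ {g | ε < L g}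
      ≤ (∫⁻ g, ENNReal.ofReal (Real.exp (l * L g)) ∂μ) / ENNReal.ofReal (Real.exp (l * ε)) :=
        (measure_mono hsub).trans (meas_ge_le_lintegral_div
          (hL.const_mul l).exp.ennreal_ofReal.aemeasurable (by simp [Real.exp_pos]) (by simp))
    _ ≤ ENNReal.ofReal (Real.exp (l * m + l ^ 2 * v)) / ENNReal.ofReal (Real.exp (l * ε)) := by
        gcongr
        exact hmgf l hl hlγ
    _ ≤ ENNReal.ofReal (Real.exp (-x)) := by
        rw [← ENNReal.ofReal_div_of_pos (Real.exp_pos _), ← Real.exp_sub]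
        gcongr
        rw [hε]
        linarith

end Tail

section Spectrum

variable {n : Type*} [Fintype n]

lemma isHermitian_transpose_mul_self (M : Matrix n n ℝ) : (Mᵀ * M).IsHermitian := by
  simpa only [conjTranspose_eq_transpose_of_trivial] using isHermitian_conjTranspose_mul_self M

variable [DecidableEq n]

lemma spectrum_mul_comm (A B : Matrix n n ℝ) : spectrum ℝ (A * B) = spectrum ℝ (B * A) := by
  ext t
  rw [mem_spectrum_iff_isRoot_charpoly, mem_spectrum_iff_isRoot_charpoly, charpoly_mul_comm]

lemma spectrum_subset_closedBall_of_norm_sub_one_le {A : Matrix n n ℝ} {γ : ℝ}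
    (h : ‖A - 1‖ ≤ γ) : spectrum ℝ A ⊆ Metric.closedBall 1 γ := by
  intro t ht
  have : Nontrivial (Matrix n n ℝ) := by
    by_contra hn
    rw [not_nontrivial_iff_subsingleton] at hn
    simp at ht
  rw [Metric.mem_closedBall, Real.dist_eq, ← Real.norm_eq_abs]
  refine (spectrum.norm_le_norm_of_mem (𝕜 := ℝ) ?_).trans h
  rw [spectrum.mem_iff] at ht ⊢
  simpa using ht

lemma dotProduct_mulVec_le_of_spectrum_le {A : Matrix n n ℝ} (hA : A.IsHermitian) {c : ℝ}
    (hc : ∀ t ∈ spectrum ℝ A, t ≤ c) (k : n → ℝ) : k ⬝ᵥ (A *ᵥ k) ≤ c * (k ⬝ᵥ k) := by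
  have hle : A ≤ algebraMap ℝ _ c := le_algebraMap_of_spectrum_le hc hA.isSelfAdjoint
  have hnonneg := (le_iff.1 hle).dotProduct_mulVec_nonneg k
  rw [sub_mulVec, dotProduct_sub, Algebra.algebraMap_eq_smul_one, smul_mulVec, one_mulVec,
    dotProduct_smul, smul_eq_mul] at hnonneg
  exact sub_nonneg.1 hnonneg

lemma card_add_log_det_le_trace {Q : Matrix n n ℝ} (hQ : Q.PosDef) :
    Fintype.card n + Real.log Q.det ≤ Q.trace := by
  have hdet := hQ.isHermitian.det_eq_prod_eigenvalues
  have htrace := hQ.isHermitian.trace_eq_sum_eigenvalues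
  simp only [RCLike.ofReal_real_eq_id, id] at hdet htrace
  rw [hdet, htrace, Real.log_prod fun i _ => (hQ.eigenvalues_pos i).ne', ← nsmul_one,
    ← Finset.card_univ, ← Finset.sum_const, ← Finset.sum_add_distrib]
  gcongr with i
  linarith [Real.log_le_sub_one_of_pos (hQ.eigenvalues_pos i)]

section EigenvaluesNearOne

variable {M : Matrix n n ℝ} {γ : ℝ}

lemma abs_eigenvalues_transpose_mul_self_sub_one_le
    (hM : spectrum ℝ (Mᵀ * M) ⊆ Metric.closedBall 1 γ) (i : n) :
    |(isHermitian_transpose_mul_self M).eigenvalues i - 1| ≤ γ :=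
  hM ((isHermitian_transpose_mul_self M).eigenvalues_mem_spectrum_real i)

lemma sum_sq_eigenvalues_sub_one_le (hM : spectrum ℝ (Mᵀ * M) ⊆ Metric.closedBall 1 γ) :
    ∑ i, ((isHermitian_transpose_mul_self M).eigenvalues i - 1) ^ 2
      ≤ Fintype.card n * γ ^ 2 := by
  rw [← nsmul_eq_mul, ← Finset.card_univ, ← Finset.sum_const]
  refine Finset.sum_le_sum fun i _ => ?_
  exact sq_le_sq' (neg_le_of_abs_le (abs_eigenvalues_transpose_mul_self_sub_one_le hM i))
    (le_of_abs_le (abs_eigenvalues_transpose_mul_self_sub_one_le hM i))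

lemma sum_eigenvalues_sub_one :
    ∑ i, ((isHermitian_transpose_mul_self M).eigenvalues i - 1)
      = (Mᵀ * M).trace - Fintype.card n := by
  rw [(isHermitian_transpose_mul_self M).trace_eq_sum_eigenvalues]
  simp

lemma trace_sub_card_sub_log_det_le (hγ : γ ≤ 1 / 2)
    (hM : spectrum ℝ (Mᵀ * M) ⊆ Metric.closedBall 1 γ) :
    (Mᵀ * M).trace - Fintype.card n - 2 * Real.log |M.det| ≤ Fintype.card n * γ ^ 2 := by
  set D := (isHermitian_transpose_mul_self M).eigenvalues
  have hD : ∀ i, |D i - 1| ≤ 1 / 2 := fun i =>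
    (abs_eigenvalues_transpose_mul_self_sub_one_le hM i).trans hγ
  have hlog : 2 * Real.log |M.det| = ∑ i, Real.log (D i) := by
    rw [← Real.log_prod fun i _ => ?_]
    · have hdet := (isHermitian_transpose_mul_self M).det_eq_prod_eigenvalues
      rw [det_mul, det_transpose, ← sq] at hdet
      simp only [RCLike.ofReal_real_eq_id, id] at hdet
      rw [← hdet, Real.log_abs, Real.log_pow, Nat.cast_ofNat]
    · linarith [neg_le_of_abs_le (hD i)]
  calc (Mᵀ * M).trace - Fintype.card n - 2 * Real.log |M.det|
      = ∑ i, (D i - 1 - Real.log (D i)) := by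
        rw [hlog, Finset.sum_sub_distrib, sum_eigenvalues_sub_one]
    _ ≤ ∑ i, (D i - 1) ^ 2 := by
        gcongr with i
        exact sub_one_sub_log_le (hD i)
    _ ≤ Fintype.card n * γ ^ 2 := sum_sq_eigenvalues_sub_one_le hM

end EigenvaluesNearOne

end Spectrum

section PrivacyLossTail

variable {ι : Type*} [Fintype ι] [DecidableEq ι]

lemma privacyLoss_eigenvectorUnitary_mulVec (M : Matrix ι ι ℝ) (k g : ι → ℝ) :
    let hM := isHermitian_transpose_mul_self M
    let U : Matrix ι ι ℝ := hM.eigenvectorUnitary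
    privacyLoss M k (U *ᵥ g) = -Real.log |M.det| + k ⬝ᵥ k / 2
      + ∑ i, ((hM.eigenvalues i - 1) * g i ^ 2 / 2 + ((M * U)ᵀ *ᵥ k) i * g i) := by
  intro hM U
  have hUU : Uᵀ * U = 1 := (mem_orthogonalGroup_iff' ι ℝ).1 hM.eigenvectorUnitary.2
  have hdiag : (M * U)ᵀ * (M * U) = diagonal hM.eigenvalues := by
    have := hM.conjStarAlgAut_star_eigenvectorUnitary
    rw [Unitary.conjStarAlgAut_apply, Unitary.coe_star, star_star, star_eq_conjTranspose,
      conjTranspose_eq_transpose_of_trivial] at this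
    rwa [transpose_mul, Matrix.mul_assoc, ← Matrix.mul_assoc Mᵀ, ← Matrix.mul_assoc]
  have hcross : ((M * U) *ᵥ g) ⬝ᵥ k = ∑ i, ((M * U)ᵀ *ᵥ k) i * g i := by
    rw [dotProduct_comm, dotProduct_mulVec, ← mulVec_transpose]
    rfl
  have hquad : (((M * U) *ᵥ g) ⬝ᵥ ((M * U) *ᵥ g) - (U *ᵥ g) ⬝ᵥ (U *ᵥ g)) / 2
      = ∑ i, (hM.eigenvalues i - 1) * g i ^ 2 / 2 := by
    rw [mulVec_dotProduct_mulVec, mulVec_dotProduct_mulVec, hUU, hdiag, ← dotProduct_sub,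
      ← sub_mulVec, ← diagonal_one, diagonal_sub, dotProduct, Finset.sum_div]
    refine Finset.sum_congr rfl fun i _ => ?_
    rw [mulVec_diagonal]
    ring
  rw [privacyLoss, mulVec_mulVec, Finset.sum_add_distrib, ← hquad, ← hcross, add_dotProduct,
    dotProduct_add, dotProduct_add, dotProduct_comm k]
  ring

lemma transpose_mulVec_dotProduct_self_le {M : Matrix ι ι ℝ} {γ : ℝ}
    (hM : spectrum ℝ (Mᵀ * M) ⊆ Metric.closedBall 1 γ) (k : ι → ℝ) :
    (Mᵀ *ᵥ k) ⬝ᵥ (Mᵀ *ᵥ k) ≤ (1 + γ) * (k ⬝ᵥ k) := by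
  rw [mulVec_dotProduct_mulVec]
  refine dotProduct_mulVec_le_of_spectrum_le (isHermitian_transpose_mul_self Mᵀ) (fun t ht => ?_) k
  rw [transpose_transpose, spectrum_mul_comm] at ht
  linarith [le_of_abs_le (show |t - 1| ≤ γ from hM ht)]

lemma lintegral_exp_privacyLoss_le_of_eigenvalues {M : Matrix ι ι ℝ} (k : ι → ℝ) {l : ℝ}
    (hl : ∀ i, |l * ((isHermitian_transpose_mul_self M).eigenvalues i - 1)| ≤ 1 / 2) :
    ∫⁻ g, ENNReal.ofReal (Real.exp (l * privacyLoss M k g)) ∂(stdGaussianPi ι)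
      ≤ ENNReal.ofReal (Real.exp (
        l * (((Mᵀ * M).trace - Fintype.card ι - 2 * Real.log |M.det| + k ⬝ᵥ k) / 2)
        + l ^ 2 * (∑ i, ((isHermitian_transpose_mul_self M).eigenvalues i - 1) ^ 2 / 2
          + (Mᵀ *ᵥ k) ⬝ᵥ (Mᵀ *ᵥ k)))) := by
  set D := (isHermitian_transpose_mul_self M).eigenvalues
  set U : Matrix ι ι ℝ := ↑(isHermitian_transpose_mul_self M).eigenvectorUnitary
  have hU : U ∈ orthogonalGroup ι ℝ := (isHermitian_transpose_mul_self M).eigenvectorUnitary.2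
  set b := (M * U)ᵀ *ᵥ k with hb
  set c := -Real.log |M.det| + k ⬝ᵥ k / 2 with hc
  have hsplit : ∀ g : ι → ℝ, ENNReal.ofReal (Real.exp (l * privacyLoss M k (U *ᵥ g)))
      = ENNReal.ofReal (Real.exp (l * c)) * ENNReal.ofReal (Real.exp
        (∑ i, ((l * (D i - 1)) * g i ^ 2 / 2 + (l * b i) * g i))) := fun g => by
    rw [privacyLoss_eigenvectorUnitary_mulVec, ← ENNReal.ofReal_mul (Real.exp_pos _).le,
      ← Real.exp_add, mul_add, Finset.mul_sum]
    congr 3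
    exact Finset.sum_congr rfl fun i _ => by ring
  have hbb : (Mᵀ *ᵥ k) ⬝ᵥ (Mᵀ *ᵥ k) = b ⬝ᵥ b := by
    rw [hb, transpose_mul, ← mulVec_mulVec, mulVec_dotProduct_mulVec Uᵀ, transpose_transpose,
      (mem_orthogonalGroup_iff ι ℝ).1 hU, one_mulVec]
  have hexponent : l * c + ∑ i, (l * (D i - 1) / 2 + (l * (D i - 1)) ^ 2 / 2 + (l * b i) ^ 2)
      = l * (((Mᵀ * M).trace - Fintype.card ι - 2 * Real.log |M.det| + k ⬝ᵥ k) / 2)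
        + l ^ 2 * (∑ i, (D i - 1) ^ 2 / 2 + (Mᵀ *ᵥ k) ⬝ᵥ (Mᵀ *ᵥ k)) := by
    rw [hbb]
    simp only [mul_pow, Finset.sum_add_distrib, ← Finset.sum_div, ← Finset.mul_sum, dotProduct]
    rw [sum_eigenvalues_sub_one, hc]
    simp only [dotProduct, ← sq]
    ring
  calc ∫⁻ g, ENNReal.ofReal (Real.exp (l * privacyLoss M k g)) ∂(stdGaussianPi ι)
      = ∫⁻ g, ENNReal.ofReal (Real.exp (l * privacyLoss M k (U *ᵥ g))) ∂(stdGaussianPi ι) :=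
        ((measurePreserving_mulVec_orthogonalGroup hU).lintegral_comp
          ((measurable_privacyLoss M k).const_mul l).exp.ennreal_ofReal).symm
    _ ≤ ENNReal.ofReal (Real.exp (l * c)) * ENNReal.ofReal (Real.exp
          (∑ i, (l * (D i - 1) / 2 + (l * (D i - 1)) ^ 2 / 2 + (l * b i) ^ 2))) := by
        simp only [hsplit]
        rw [lintegral_const_mul _ (by fun_prop)]
        gcongr
        exact lintegral_exp_quadratic_stdGaussianPi_le hl
    _ = _ := by rw [← ENNReal.ofReal_mul (Real.exp_pos _).le, ← Real.exp_add, hexponent]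

lemma lintegral_exp_privacyLoss_le {M : Matrix ι ι ℝ} {γ : ℝ} (hγ : γ ≤ 1 / 2)
    (hM : spectrum ℝ (Mᵀ * M) ⊆ Metric.closedBall 1 γ) (k : ι → ℝ) {l : ℝ} (hl : 0 ≤ l)
    (hlγ : l * γ ≤ 1 / 2) :
    ∫⁻ g, ENNReal.ofReal (Real.exp (l * privacyLoss M k g)) ∂(stdGaussianPi ι)
      ≤ ENNReal.ofReal (Real.exp (l * ((Fintype.card ι * γ ^ 2 + k ⬝ᵥ k) / 2)
          + l ^ 2 * ((Fintype.card ι * γ ^ 2 + 3 * (k ⬝ᵥ k)) / 2))) := by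
  have hadmissible : ∀ i,
      |l * ((isHermitian_transpose_mul_self M).eigenvalues i - 1)| ≤ 1 / 2 := fun i => by
    rw [abs_mul, abs_of_nonneg hl]
    exact (mul_le_mul_of_nonneg_left
      (abs_eigenvalues_transpose_mul_self_sub_one_le hM i) hl).trans hlγ
  refine (lintegral_exp_privacyLoss_le_of_eigenvalues k hadmissible).trans ?_
  gcongr
  · exact trace_sub_card_sub_log_det_le hγ hM
  · have hk : 0 ≤ k ⬝ᵥ k := dotProduct_star_self_nonneg k
    rw [← Finset.sum_div]
    nlinarith [sum_sq_eigenvalues_sub_one_le hM, transpose_mulVec_dotProduct_self_le hM k]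

theorem stdGaussianPi_lt_privacyLoss_le {M : Matrix ι ι ℝ} {γ : ℝ} (hγ₀ : 0 < γ) (hγ : γ ≤ 1 / 2)
    (hM : spectrum ℝ (Mᵀ * M) ⊆ Metric.closedBall 1 γ) (k : ι → ℝ) {x : ℝ} (hx : 0 ≤ x) :
    stdGaussianPi ι {g | (Fintype.card ι * γ ^ 2 + k ⬝ᵥ k) / 2
        + 2 * √(x * ((Fintype.card ι * γ ^ 2 + 3 * (k ⬝ᵥ k)) / 2)) + 2 * γ * x
        < privacyLoss M k g} ≤ ENNReal.ofReal (Real.exp (-x)) := by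
  have hk : 0 ≤ k ⬝ᵥ k := dotProduct_star_self_nonneg k
  exact measure_lt_le_of_lintegral_exp_le _ (measurable_privacyLoss M k) hγ₀ (by positivity) hx
    fun l hl hlγ => lintegral_exp_privacyLoss_le hγ hM k hl hlγ

end PrivacyLossTail

section SqrtRatio

variable {n : Type*} {A B : Matrix n n ℝ}

lemma transpose_eq_self_of_posDef (hA : A.PosDef) : Aᵀ = A := by
  simpa only [conjTranspose_eq_transpose_of_trivial] using hA.isHermitian.eq

variable [Fintype n] [DecidableEq n]

lemma posDef_sqrt (hA : A.PosDef) : (CFC.sqrt A).PosDef :=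
  (IsStrictlyPositive.sqrt A hA.isStrictlyPositive).posDef

lemma sqrt_mul_sqrt (hA : A.PosDef) : CFC.sqrt A * CFC.sqrt A = A :=
  CFC.sqrt_mul_sqrt_self A hA.posSemidef.nonneg

lemma isUnit_det_sqrt (hA : A.PosDef) : IsUnit (CFC.sqrt A).det :=
  (posDef_sqrt hA).det_pos.ne'.isUnit

lemma eq_of_sqrt_inv_mul_mul_sqrt_inv_eq_one (hB : B.PosDef)
    (h : (CFC.sqrt B)⁻¹ * A * (CFC.sqrt B)⁻¹ = 1) : A = B := by
  calc A = CFC.sqrt B * ((CFC.sqrt B)⁻¹ * A * (CFC.sqrt B)⁻¹) * CFC.sqrt B := by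
        rw [Matrix.mul_assoc (CFC.sqrt B)⁻¹, mul_nonsing_inv_cancel_left _ _ (isUnit_det_sqrt hB),
          nonsing_inv_mul_cancel_right _ _ (isUnit_det_sqrt hB)]
    _ = B := by rw [h, Matrix.mul_one, sqrt_mul_sqrt hB]

-- `B⁻¹ * A` is not symmetric, but it is similar to the positive definite `B^{-1/2} A B^{-1/2}`.
lemma card_add_log_det_inv_mul_le_trace (hA : A.PosDef) (hB : B.PosDef) :
    Fintype.card n + Real.log (B⁻¹ * A).det ≤ (B⁻¹ * A).trace := by
  have hB' : (CFC.sqrt B)⁻¹ * (CFC.sqrt B)⁻¹ = B⁻¹ := by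
    rw [← Matrix.mul_inv_rev, sqrt_mul_sqrt hB]
  have hQ : ((CFC.sqrt B)⁻¹ * A * (CFC.sqrt B)⁻¹).PosDef := by
    have hS := (posDef_sqrt hB).inv
    simpa only [hS.isHermitian.eq] using
      hA.conjTranspose_mul_mul_same (mulVec_injective_of_isUnit hS.isUnit)
  have h := card_add_log_det_le_trace hQ
  rwa [trace_mul_cycle, hB', det_mul, det_mul, mul_right_comm, ← det_mul, hB', ← det_mul] at h

lemma trace_inv_mul_sub_one_le (hA : A.PosDef) (hB : B.PosDef) {γ : ℝ} (hγ : γ ≤ 1 / 2)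
    (h : spectrum ℝ ((B⁻¹ * A)ᵀ * (B⁻¹ * A)) ⊆ Metric.closedBall 1 γ) :
    ((B⁻¹ * A - 1)ᵀ * (B⁻¹ * A - 1)).trace ≤ Fintype.card n * γ ^ 2 := by
  have hdet : 0 < (B⁻¹ * A).det := by
    rw [det_mul]
    exact mul_pos hB.inv.det_pos hA.det_pos
  have hlog := trace_sub_card_sub_log_det_le hγ h
  rw [abs_of_pos hdet] at hlog
  have htrace := card_add_log_det_inv_mul_le_trace hA hB
  calc ((B⁻¹ * A - 1)ᵀ * (B⁻¹ * A - 1)).trace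
      = ((B⁻¹ * A)ᵀ * (B⁻¹ * A)).trace - 2 * (B⁻¹ * A).trace + Fintype.card n := by
        rw [transpose_sub, transpose_one, Matrix.sub_mul, Matrix.mul_sub, Matrix.mul_sub]
        simp only [Matrix.mul_one, Matrix.one_mul, trace_sub, trace_transpose, trace_one]
        ring
    _ ≤ Fintype.card n * γ ^ 2 := by linarith

/-- The matrix `B^{-1/2} A^{1/2}` through which the noisy factor of `A` is compared with that of
`B`. -/
noncomputable def sqrtRatio (A B : Matrix n n ℝ) : Matrix n n ℝ := (CFC.sqrt B)⁻¹ * CFC.sqrt A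

lemma det_sqrtRatio_pos (hA : A.PosDef) (hB : B.PosDef) : 0 < (sqrtRatio A B).det := by
  rw [sqrtRatio, det_mul]
  exact mul_pos (posDef_sqrt hB).inv.det_pos (posDef_sqrt hA).det_pos

lemma sqrtRatio_mul_transpose (hA : A.PosDef) (hB : B.PosDef) :
    sqrtRatio A B * (sqrtRatio A B)ᵀ = (CFC.sqrt B)⁻¹ * A * (CFC.sqrt B)⁻¹ := by
  rw [sqrtRatio, transpose_mul, transpose_eq_self_of_posDef (posDef_sqrt hB).inv,
    transpose_eq_self_of_posDef (posDef_sqrt hA), ← Matrix.mul_assoc,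
    Matrix.mul_assoc _ (CFC.sqrt A) (CFC.sqrt A), sqrt_mul_sqrt hA]

lemma spectrum_transpose_mul_sqrtRatio_subset (hA : A.PosDef) (hB : B.PosDef) {γ : ℝ}
    (h : ‖(CFC.sqrt B)⁻¹ * A * (CFC.sqrt B)⁻¹ - 1‖ ≤ γ) :
    spectrum ℝ ((sqrtRatio A B)ᵀ * sqrtRatio A B) ⊆ Metric.closedBall 1 γ := by
  rw [spectrum_mul_comm, sqrtRatio_mul_transpose hA hB]
  exact spectrum_subset_closedBall_of_norm_sub_one_le h

lemma sqrt_mul_one_add_smul_sqrtRatio (hB : B.PosDef) {η : ℝ} (hη : η ≠ 0) (G : Matrix n n ℝ) :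
    CFC.sqrt B * (1 + η • (sqrtRatio A B * G + η⁻¹ • (sqrtRatio A B - 1)))
      = CFC.sqrt A * (1 + η • G) := by
  have hfactor : 1 + η • (sqrtRatio A B * G + η⁻¹ • (sqrtRatio A B - 1))
      = sqrtRatio A B * (1 + η • G) := by
    rw [smul_add, smul_smul, mul_inv_cancel₀ hη, one_smul, Matrix.mul_add, Matrix.mul_one,
      Matrix.mul_smul]
    abel
  rw [hfactor, sqrtRatio, Matrix.mul_assoc, mul_nonsing_inv_cancel_left _ _ (isUnit_det_sqrt hB)]

end SqrtRatio

section Vectorization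

variable {n : Type*}

/-- The square matrix with the given family of entries, as a linear equivalence. Unlike for
`Matrix.vec`, the first index is the row. -/
def ofEntries : (n × n → ℝ) ≃ₗ[ℝ] Matrix n n ℝ :=
  LinearEquiv.curry ℝ ℝ n n ≪≫ₗ Matrix.ofLinearEquiv ℝ

lemma ofEntries_apply (g : n × n → ℝ) (i j : n) : ofEntries g i j = g (i, j) := rfl

lemma ofEntries_symm_apply (W : Matrix n n ℝ) (p : n × n) : ofEntries.symm W p = W p.1 p.2 := rfl

lemma continuous_ofEntries : Continuous (ofEntries : (n × n → ℝ) → Matrix n n ℝ) :=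
  continuous_matrix fun i j => continuous_apply (i, j)

variable [Fintype n]

lemma ofEntries_symm_dotProduct_self (W : Matrix n n ℝ) :
    ofEntries.symm W ⬝ᵥ ofEntries.symm W = (Wᵀ * W).trace := by
  simp only [dotProduct, Fintype.sum_prod_type_right, trace, diag_apply, mul_apply,
    transpose_apply, ofEntries_symm_apply]

variable [DecidableEq n]

lemma ofEntries_kronecker_mulVec (P : Matrix n n ℝ) (g : n × n → ℝ) :
    ofEntries ((P ⊗ₖ (1 : Matrix n n ℝ)) *ᵥ g) = P * ofEntries g := by
  ext i j
  simp [ofEntries_apply, mulVec, dotProduct, mul_apply, Fintype.sum_prod_type, one_apply]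

lemma spectrum_kronecker_one_subset (X : Matrix n n ℝ) :
    spectrum ℝ (X ⊗ₖ (1 : Matrix n n ℝ)) ⊆ spectrum ℝ X := by
  intro t ht hX
  refine ht ?_
  rw [spectrum.mem_resolventSet_iff] at hX ⊢
  have hsub : algebraMap ℝ (Matrix (n × n) (n × n) ℝ) t - X ⊗ₖ 1
      = (algebraMap ℝ (Matrix n n ℝ) t - X) ⊗ₖ 1 := by
    rw [sub_eq_iff_eq_add, ← add_kronecker, sub_add_cancel, Algebra.algebraMap_eq_smul_one,
      Algebra.algebraMap_eq_smul_one, smul_kronecker, one_kronecker_one]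
  rw [hsub, isUnit_iff_isUnit_det, det_kronecker, det_one, one_pow, mul_one]
  exact ((isUnit_iff_isUnit_det _).1 hX).pow _

lemma spectrum_transpose_mul_kronecker_one_subset (P : Matrix n n ℝ) :
    spectrum ℝ ((P ⊗ₖ (1 : Matrix n n ℝ))ᵀ * P ⊗ₖ (1 : Matrix n n ℝ)) ⊆ spectrum ℝ (Pᵀ * P) := by
  rw [← kroneckerMap_transpose, ← mul_kronecker_mul, transpose_one, Matrix.one_mul]
  exact spectrum_kronecker_one_subset _

end Vectorization

section Indistinguishability

variable {Z Z' : Type*} [MeasurableSpace Z] [MeasurableSpace Z'] {μ ν : Measure Z} {ε δ : ℝ}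

lemma indistinguishable_of_one_le (μ ν : Measure Z) [IsProbabilityMeasure μ]
    [IsProbabilityMeasure ν] (ε : ℝ) (hδ : 1 ≤ δ) : Indistinguishable μ ν ε δ := by
  have hone : (1 : ℝ≥0∞) ≤ ENNReal.ofReal δ := ENNReal.one_le_ofReal.2 hδ
  exact fun S _ => ⟨(prob_le_one.trans hone).trans le_add_self,
    (prob_le_one.trans hone).trans le_add_self⟩

lemma indistinguishable_self (μ : Measure Z) (hε : 0 ≤ ε) (δ : ℝ) : Indistinguishable μ μ ε δ := by
  have hone : (1 : ℝ≥0∞) ≤ ENNReal.ofReal (Real.exp ε) :=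
    ENNReal.one_le_ofReal.2 (Real.one_le_exp hε)
  have hle : ∀ S, μ S ≤ ENNReal.ofReal (Real.exp ε) * μ S + ENNReal.ofReal δ := fun S =>
    le_add_right (le_mul_of_one_le_left zero_le hone)
  exact fun S _ => ⟨hle S, hle S⟩

lemma Indistinguishable.map (h : Indistinguishable μ ν ε δ) {f : Z → Z'} (hf : Measurable f) :
    Indistinguishable (μ.map f) (ν.map f) ε δ := by
  intro S hS
  rw [Measure.map_apply hf hS, Measure.map_apply hf hS]
  exact h _ (hf hS)

lemma Indistinguishable.mono (h : Indistinguishable μ ν ε δ) {ε' : ℝ} (hε : ε ≤ ε') :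
    Indistinguishable μ ν ε' δ := fun S hS =>
  ⟨(h S hS).1.trans (by gcongr), (h S hS).2.trans (by gcongr)⟩

end Indistinguishability

section NoisyFactor

variable {d : ℕ} {η : ℝ} {A B A₁ A₂ : Matrix (Fin d) (Fin d) ℝ} {γ δ₀ : ℝ}

instance : BorelSpace (Matrix (Fin d) (Fin d) ℝ) :=
  inferInstanceAs (BorelSpace (Fin d → Fin d → ℝ))

lemma continuous_mul_one_add_smul (η : ℝ) (A : Matrix (Fin d) (Fin d) ℝ) :
    Continuous fun G : Matrix (Fin d) (Fin d) ℝ => A * (1 + η • G) := by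
  fun_prop

lemma gaussianMatrix_eq_map_ofEntries :
    gaussianMatrix d = (stdGaussianPi (Fin d × Fin d)).map ofEntries := rfl

instance : IsProbabilityMeasure (gaussianMatrix d) :=
  Measure.isProbabilityMeasure_map continuous_ofEntries.measurable.aemeasurable

instance : IsProbabilityMeasure (noisyFactor η A) :=
  Measure.isProbabilityMeasure_map (continuous_mul_one_add_smul η _).measurable.aemeasurable

lemma noisyFactor_eq_map_stdGaussianPi (η : ℝ) (A : Matrix (Fin d) (Fin d) ℝ) :
    noisyFactor η A
      = (stdGaussianPi (Fin d × Fin d)).map fun g => CFC.sqrt A * (1 + η • ofEntries g) :=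
  Measure.map_map (continuous_mul_one_add_smul η _).measurable continuous_ofEntries.measurable

/-- The vectorized mean of the Gaussian matrix `P * G + η⁻¹ • (P - 1)`, where `P = sqrtRatio A B`:
replacing `G` by this matrix turns the noisy factor of `B` into that of `A`. -/
noncomputable def noiseShift (η : ℝ) (A B : Matrix (Fin d) (Fin d) ℝ) : Fin d × Fin d → ℝ :=
  ofEntries.symm (η⁻¹ • (sqrtRatio A B - 1))

lemma noisyFactor_eq_map_map_mulVec_add (hη : η ≠ 0) (hB : B.PosDef) :
    noisyFactor η A = ((stdGaussianPi (Fin d × Fin d)).map fun g =>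
      (sqrtRatio A B ⊗ₖ (1 : Matrix (Fin d) (Fin d) ℝ)) *ᵥ g + noiseShift η A B).map
      fun g => CFC.sqrt B * (1 + η • ofEntries g) := by
  have hcont : Continuous fun g => CFC.sqrt B * (1 + η • ofEntries g) :=
    (continuous_mul_one_add_smul η _).comp continuous_ofEntries
  rw [Measure.map_map hcont.measurable (continuous_mulVec_add _ _).measurable,
    noisyFactor_eq_map_stdGaussianPi]
  congr 1
  funext g
  simp only [Function.comp_apply, noiseShift, map_add, ofEntries_kronecker_mulVec,
    LinearEquiv.apply_symm_apply, sqrt_mul_one_add_smul_sqrtRatio hB hη]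

lemma noisyFactor_le_exp_mul_add_privacyLoss (hη : η ≠ 0) (hA : A.PosDef) (hB : B.PosDef) (ε : ℝ)
    {S : Set (Matrix (Fin d) (Fin d) ℝ)} (hS : MeasurableSet S) :
    noisyFactor η A S ≤ ENNReal.ofReal (Real.exp ε) * noisyFactor η B S
      + stdGaussianPi (Fin d × Fin d) {g | ε < privacyLoss (sqrtRatio A B ⊗ₖ 1)
          (noiseShift η A B) g} := by
  have hF : Measurable fun g => CFC.sqrt B * (1 + η • ofEntries g) :=
    ((continuous_mul_one_add_smul η _).comp continuous_ofEntries).measurable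
  have hdet : (sqrtRatio A B ⊗ₖ (1 : Matrix (Fin d) (Fin d) ℝ)).det ≠ 0 := by
    rw [det_kronecker, det_one, one_pow, mul_one]
    exact pow_ne_zero _ (det_sqrtRatio_pos hA hB).ne'
  rw [noisyFactor_eq_map_map_mulVec_add hη hB, noisyFactor_eq_map_stdGaussianPi,
    Measure.map_apply hF hS, Measure.map_apply hF hS]
  exact map_mulVec_add_stdGaussianPi_le_exp_mul_add hdet _ ε (hF hS)

lemma noiseShift_dotProduct_self_le (hA : A.PosDef) (hB : B.PosDef) (hγ : γ ≤ 1 / 2)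
    (h : ‖(CFC.sqrt B)⁻¹ * A * (CFC.sqrt B)⁻¹ - 1‖ ≤ γ) (η : ℝ) :
    noiseShift η A B ⬝ᵥ noiseShift η A B ≤ d * γ ^ 2 / η ^ 2 := by
  have htrace := trace_inv_mul_sub_one_le (posDef_sqrt hA) (posDef_sqrt hB) hγ
    (spectrum_transpose_mul_sqrtRatio_subset hA hB h)
  rw [Fintype.card_fin] at htrace
  calc _ = ((sqrtRatio A B - 1)ᵀ * (sqrtRatio A B - 1)).trace / η ^ 2 := by
        rw [noiseShift, map_smul, smul_dotProduct, dotProduct_smul,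
          ofEntries_symm_dotProduct_self, smul_eq_mul, smul_eq_mul]
        ring
    _ ≤ d * γ ^ 2 / η ^ 2 := by
        gcongr
        exact htrace

lemma tail_level_le_epsZero (d : ℕ) (hη : 0 < η) (hγ : 0 ≤ γ) (hlog : 0 ≤ Real.log (2 / δ₀))
    {κ : ℝ} (hκ : κ ≤ d * γ ^ 2 / η ^ 2) :
    (d * d * γ ^ 2 + κ) / 2 + 2 * √(Real.log (2 / δ₀) * ((d * d * γ ^ 2 + 3 * κ) / 2))
      + 2 * γ * Real.log (2 / δ₀) ≤ epsZero d η γ δ₀ := by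
  rw [epsZero]
  set x := Real.log (2 / δ₀)
  have hsq : d * γ ^ 2 / η ^ 2 = (γ * √d / η) ^ 2 := by
    rw [div_pow, mul_pow, Real.sq_sqrt d.cast_nonneg, mul_comm]
  have hcross : 0 ≤ (d * γ) * (γ * √d / η) := by positivity
  have hsqrt : √(x * ((d * d * γ ^ 2 + 3 * κ) / 2)) ≤ √x * (d * γ + 3 / 2 * (γ * √d / η)) := by
    rw [Real.sqrt_mul hlog]
    refine mul_le_mul_of_nonneg_left (Real.sqrt_le_iff.2 ⟨by positivity, ?_⟩) (Real.sqrt_nonneg x)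
    nlinarith [sq_nonneg (d * γ), sq_nonneg (γ * √d / η)]
  calc _ ≤ (d * d * γ ^ 2 + d * γ ^ 2 / η ^ 2) / 2
        + 2 * (√x * (d * γ + 3 / 2 * (γ * √d / η))) + 2 * γ * x := by gcongr
    _ = _ := by ring

lemma noisyFactor_le_exp_epsZero_mul_add (hη : 0 < η) (hA : A.PosDef) (hB : B.PosDef)
    (hγ₀ : 0 < γ) (hγ : γ ≤ 1 / 2) (h : ‖(CFC.sqrt B)⁻¹ * A * (CFC.sqrt B)⁻¹ - 1‖ ≤ γ)
    (hδ₀ : 0 < δ₀) (hδ₂ : δ₀ ≤ 2) {S : Set (Matrix (Fin d) (Fin d) ℝ)} (hS : MeasurableSet S) :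
    noisyFactor η A S
      ≤ ENNReal.ofReal (Real.exp (epsZero d η γ δ₀)) * noisyFactor η B S
        + ENNReal.ofReal δ₀ := by
  have hlog : 0 ≤ Real.log (2 / δ₀) := Real.log_nonneg ((one_le_div hδ₀).2 hδ₂)
  have hspec : spectrum ℝ ((sqrtRatio A B ⊗ₖ (1 : Matrix (Fin d) (Fin d) ℝ))ᵀ
      * sqrtRatio A B ⊗ₖ (1 : Matrix (Fin d) (Fin d) ℝ)) ⊆ Metric.closedBall 1 γ :=
    (spectrum_transpose_mul_kronecker_one_subset _).trans
      (spectrum_transpose_mul_sqrtRatio_subset hA hB h)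
  have hlevel := tail_level_le_epsZero d hη hγ₀.le hlog
    (noiseShift_dotProduct_self_le hA hB hγ h η)
  have hexp : Real.exp (-Real.log (2 / δ₀)) ≤ δ₀ := by
    rw [Real.exp_neg, Real.exp_log (by positivity), inv_div]
    linarith
  have htail := stdGaussianPi_lt_privacyLoss_le hγ₀ hγ hspec (noiseShift η A B) hlog
  simp only [Fintype.card_prod, Fintype.card_fin, Nat.cast_mul] at htail
  refine (noisyFactor_le_exp_mul_add_privacyLoss hη.ne' hA hB (epsZero d η γ δ₀) hS).trans ?_
  gcongr
  exact (measure_mono fun g hg => hlevel.trans_lt hg).trans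
    (htail.trans (ENNReal.ofReal_le_ofReal hexp))

theorem noisyFactor_indistinguishable (hη : 0 < η) (h₁ : A₁.PosDef) (h₂ : A₂.PosDef)
    (h : specDist A₁ A₂ ≤ γ) (hγ : γ ≤ 1 / 2) (hδ₀ : 0 < δ₀) :
    Indistinguishable (noisyFactor η A₁) (noisyFactor η A₂) (epsZero d η γ δ₀) δ₀ := by
  obtain ⟨h₁₂, h₂₁⟩ := max_le_iff.1 h
  rcases le_total 1 δ₀ with hδ | hδ
  · exact indistinguishable_of_one_le _ _ _ hδ
  rcases ((norm_nonneg _).trans h₁₂).eq_or_lt with hzero | hpos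
  · have heq : A₁ = A₂ := eq_of_sqrt_inv_mul_mul_sqrt_inv_eq_one h₂
      (sub_eq_zero.1 (norm_le_zero_iff.1 (h₂₁.trans hzero.ge)))
    rw [heq]
    exact indistinguishable_self _ (by simp [epsZero, ← hzero]) _
  · exact fun S hS =>
      ⟨noisyFactor_le_exp_epsZero_mul_add hη h₁ h₂ hpos hγ h₂₁ hδ₀ (by linarith) hS,
        noisyFactor_le_exp_epsZero_mul_add hη h₂ h₁ hpos hγ h₁₂ hδ₀ (by linarith) hS⟩

end NoisyFactor

section CovMechanism

variable {d : ℕ} {η : ℝ} {A A₁ A₂ : Matrix (Fin d) (Fin d) ℝ}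

lemma continuous_mul_transpose_self :
    Continuous fun Z : Matrix (Fin d) (Fin d) ℝ => Z * Zᵀ := by
  fun_prop

lemma covMechanism_eq_map_noisyFactor (hA : A.PosDef) :
    covMechanism η A = (noisyFactor η A).map fun Z => Z * Zᵀ := by
  rw [noisyFactor, Measure.map_map continuous_mul_transpose_self.measurable
    (continuous_mul_one_add_smul η _).measurable, covMechanism]
  congr 1
  funext G
  simp only [Function.comp_apply, transpose_mul, transpose_eq_self_of_posDef (posDef_sqrt hA),
    Matrix.mul_assoc]

theorem covMechanism_indistinguishable (hη : 0 < η) (h₁ : A₁.PosDef) (h₂ : A₂.PosDef) {γ δ₀ : ℝ}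
    (h : specDist A₁ A₂ ≤ γ) (hγ : γ ≤ 1 / 2) (hδ₀ : 0 < δ₀) :
    Indistinguishable (covMechanism η A₁) (covMechanism η A₂) (epsZero d η γ δ₀) δ₀ := by
  rw [covMechanism_eq_map_noisyFactor h₁, covMechanism_eq_map_noisyFactor h₂]
  exact (noisyFactor_indistinguishable hη h₁ h₂ h hγ hδ₀).map
    continuous_mul_transpose_self.measurable

lemma finite_setOf_det_smul_one_add_eq_zero {n : Type*} [Fintype n] [DecidableEq n]
    (W : Matrix n n ℝ) : {t : ℝ | (t • (1 : Matrix n n ℝ) + W).det = 0}.Finite := by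
  refine (finite_real_spectrum (A := -W)).subset fun t ht => ?_
  rw [spectrum.mem_iff, Algebra.algebraMap_eq_smul_one, sub_neg_eq_add, isUnit_iff_isUnit_det]
  exact fun h => h.ne_zero ht

-- On each line in the direction of the identity matrix the determinant has finitely many zeros.
lemma ae_volume_det_add_smul_ofEntries_ne_zero {n : Type*} [Fintype n] [DecidableEq n]
    (hη : η ≠ 0) (C : Matrix n n ℝ) : ∀ᵐ g : n × n → ℝ, (C + η • ofEntries g).det ≠ 0 := by
  have hcont : Continuous fun g : n × n → ℝ => (C + η • ofEntries g).det :=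
    (continuous_const.add (continuous_ofEntries.const_smul η)).matrix_det
  refine ae_mem_of_ae_add_linearMap_mem (s := {g | (C + η • ofEntries g).det ≠ 0})
    (LinearMap.toSpanSingleton ℝ _ (ofEntries.symm (1 : Matrix n n ℝ))) volume volume
    (hcont.measurable (measurableSet_singleton 0)).compl fun g => ?_
  have hline : ∀ t : ℝ, C + η • ofEntries (g + t • ofEntries.symm 1)
      = η • (t • 1 + (η⁻¹ • C + ofEntries g)) := fun t => by
    rw [map_add, map_smul, LinearEquiv.apply_symm_apply, smul_add, smul_add, smul_add,
      smul_inv_smul₀ hη]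
    abel
  refine measure_mono_null (fun t ht => ?_)
    ((finite_setOf_det_smul_one_add_eq_zero (η⁻¹ • C + ofEntries g)).measure_zero volume)
  have hzero : (C + η • ofEntries (g + t • ofEntries.symm 1)).det = 0 := not_not.1 ht
  rw [hline, det_smul] at hzero
  exact (mul_eq_zero.1 hzero).resolve_left (pow_ne_zero _ hη)

lemma ae_det_add_smul_ne_zero (hη : η ≠ 0) (C : Matrix (Fin d) (Fin d) ℝ) :
    ∀ᵐ G ∂(gaussianMatrix d), (C + η • G).det ≠ 0 := by
  have hcont : Continuous fun G : Matrix (Fin d) (Fin d) ℝ => (C + η • G).det := by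
    fun_prop
  rw [gaussianMatrix_eq_map_ofEntries]
  refine (ae_map_iff continuous_ofEntries.measurable.aemeasurable
    (hcont.measurable (measurableSet_singleton 0)).compl).2 ?_
  exact stdGaussianPi_absolutelyContinuous.ae_le (ae_volume_det_add_smul_ofEntries_ne_zero hη C)

lemma posDef_mul_mul_transpose_mul {n : Type*} [Fintype n] [DecidableEq n] {A W : Matrix n n ℝ}
    (hA : A.PosDef) (hW : W.det ≠ 0) : (A * W * Wᵀ * A).PosDef := by
  have hunit : IsUnit (A * W)ᵀ := by
    rw [isUnit_iff_isUnit_det, det_transpose, det_mul]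
    exact (mul_ne_zero hA.det_pos.ne' hW).isUnit
  have h := PosDef.conjTranspose_mul_self (A * W)ᵀ (mulVec_injective_of_isUnit hunit)
  rwa [conjTranspose_eq_transpose_of_trivial, transpose_transpose, transpose_mul,
    transpose_eq_self_of_posDef hA, ← Matrix.mul_assoc] at h

lemma measurableSet_posDef : MeasurableSet {A : Matrix (Fin d) (Fin d) ℝ | A.PosDef} := by
  have hsymm : IsClosed {A : Matrix (Fin d) (Fin d) ℝ | A.IsHermitian} :=
    isClosed_eq continuous_id.matrix_conjTranspose continuous_id
  have hnonneg : IsClosed (⋂ x : Fin d → ℝ,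
      {A : Matrix (Fin d) (Fin d) ℝ | 0 ≤ star x ⬝ᵥ (A *ᵥ x)}) :=
    isClosed_iInter fun x => isClosed_le continuous_const
      (continuous_const.dotProduct (continuous_id.matrix_mulVec continuous_const))
  have hdet : IsOpen {A : Matrix (Fin d) (Fin d) ℝ | A.det ≠ 0} :=
    isOpen_ne_fun continuous_id.matrix_det continuous_const
  convert (hsymm.measurableSet.inter hnonneg.measurableSet).inter hdet.measurableSet using 1
  ext A
  constructor
  · exact fun hA => ⟨⟨hA.isHermitian, Set.mem_iInter.2 fun x =>
      hA.posSemidef.dotProduct_mulVec_nonneg x⟩, hA.det_pos.ne'⟩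
  · rintro ⟨⟨hA, hquad⟩, hA_det⟩
    exact (PosSemidef.of_dotProduct_mulVec_nonneg hA fun x =>
      Set.mem_iInter.1 hquad x).posDef_iff_det_ne_zero.2 hA_det

lemma isProbabilityMeasure_covMechanism (hA : A.PosDef) :
    IsProbabilityMeasure (covMechanism η A) := by
  rw [covMechanism_eq_map_noisyFactor hA]
  exact Measure.isProbabilityMeasure_map continuous_mul_transpose_self.measurable.aemeasurable

lemma ae_posDef_covMechanism (hη : η ≠ 0) (hA : A.PosDef) :
    ∀ᵐ Z ∂(covMechanism η A), Z.PosDef := by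
  have hcont : Continuous fun G : Matrix (Fin d) (Fin d) ℝ =>
      CFC.sqrt A * (1 + η • G) * (1 + η • G)ᵀ * CFC.sqrt A := by
    fun_prop
  rw [covMechanism, ae_map_iff hcont.measurable.aemeasurable measurableSet_posDef]
  filter_upwards [ae_det_add_smul_ne_zero hη 1] with G hG
  exact posDef_mul_mul_transpose_mul (posDef_sqrt hA) hG

end CovMechanism

section MaskRadius

variable {d : ℕ} {η ε δ : ℝ}

lemma maskRadius_le_half (hδ : 0 < Real.log (2 / δ)) (hε : ε ≤ 4 * Real.log (2 / δ)) :
    maskRadius d η ε δ ≤ 1 / 2 := by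
  refine (min_le_right _ _).trans ((min_le_left _ _).trans ?_)
  rw [div_le_iff₀ (by positivity)]
  linarith

lemma maskRadius_nonneg (hη : 0 ≤ η) (hε : 0 ≤ ε) (hδ : 0 ≤ Real.log (2 / δ)) :
    0 ≤ maskRadius d η ε δ :=
  le_min (le_min (by positivity) (by positivity)) (le_min (by positivity) (by positivity))

-- Each of the four terms of the minimum bounds one summand of `epsZero` by `ε / 4`.
lemma epsZero_maskRadius_le (hd : 0 < d) (hη : 0 < η) (hε : 0 ≤ ε) (hδ : 0 < Real.log (2 / δ)) :
    epsZero d η (maskRadius d η ε δ) δ ≤ ε := by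
  have hγ := maskRadius_nonneg (d := d) hη.le hε hδ.le
  rw [epsZero]
  set γ := maskRadius d η ε δ
  set x := Real.log (2 / δ)
  have hquad : γ ^ 2 * d / 2 * (d + 1 / η ^ 2) ≤ ε / 4 := by
    have h : γ ≤ √(ε / (2 * d * (d + 1 / η ^ 2))) := (min_le_left _ _).trans (min_le_left _ _)
    rw [Real.le_sqrt hγ (by positivity), le_div_iff₀ (by positivity)] at h
    linarith
  have hdim : 2 * d * γ * √x ≤ ε / 4 := by
    have h : γ ≤ ε / (8 * d * √x) := (min_le_left _ _).trans (min_le_right _ _)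
    rw [le_div_iff₀ (by positivity)] at h
    linarith
  have hlog : 2 * γ * x ≤ ε / 4 := by
    have h : γ ≤ ε / (8 * x) := (min_le_right _ _).trans (min_le_left _ _)
    rw [le_div_iff₀ (by positivity)] at h
    linarith
  have hnoise : 3 * γ * √d * √x / η ≤ ε / 4 := by
    have h : γ ≤ ε * η / (12 * √d * √x) := (min_le_right _ _).trans (min_le_right _ _)
    rw [le_div_iff₀ (by positivity)] at h
    rw [div_le_iff₀ hη]
    linarith
  linarith

theorem covMechanism_isMaskingMechanism (hd : 0 < d) (hη : 0 < η) (hε : 0 ≤ ε) (hδ₀ : 0 < δ)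
    (hδ : 0 < Real.log (2 / δ)) (hεδ : ε ≤ 4 * Real.log (2 / δ)) :
    IsMaskingMechanism {A : Matrix (Fin d) (Fin d) ℝ | A.PosDef} specDist (covMechanism η)
      (maskRadius d η ε δ) ε δ :=
  ⟨fun _ hA => ⟨isProbabilityMeasure_covMechanism hA, ae_posDef_covMechanism hη.ne' hA⟩,
    fun _ h₁ _ h₂ h =>
      (covMechanism_indistinguishable hη h₁ h₂ h (maskRadius_le_half hδ hεδ) hδ₀).mono
        (epsZero_maskRadius_le hd hη hε hδ)⟩

end MaskRadius

end CovMask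

theorem mainTheorem8 (d : ℕ) (hd : 1 ≤ d) (η : ℝ) (hη : 0 < η) :
    (∀ A₁ A₂ : Matrix (Fin d) (Fin d) ℝ, A₁.PosDef → A₂.PosDef →
      ∀ γ : ℝ, CovMask.specDist A₁ A₂ ≤ γ → γ ≤ 1 / 2 → ∀ δ₀ : ℝ, 0 < δ₀ →
        CovMask.Indistinguishable (CovMask.noisyFactor η A₁) (CovMask.noisyFactor η A₂)
          (CovMask.epsZero d η γ δ₀) δ₀ ∧
        CovMask.Indistinguishable (CovMask.covMechanism η A₁) (CovMask.covMechanism η A₂)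
          (CovMask.epsZero d η γ δ₀) δ₀) ∧
    (∀ ε δ : ℝ, 0 < ε → ε ≤ 1 → 0 < δ → δ ≤ 1 →
      CovMask.IsMaskingMechanism {A : Matrix (Fin d) (Fin d) ℝ | A.PosDef} CovMask.specDist
        (CovMask.covMechanism η) (CovMask.maskRadius d η ε δ) ε δ) := by
  refine ⟨fun A₁ A₂ h₁ h₂ γ h hγ δ₀ hδ₀ => ⟨?_, ?_⟩, fun ε δ hε hε₁ hδ hδ₁ => ?_⟩
  · exact CovMask.noisyFactor_indistinguishable hη h₁ h₂ h hγ hδ₀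
  · exact CovMask.covMechanism_indistinguishable hη h₁ h₂ h hγ hδ₀
  · have hlog : Real.log 2 ≤ Real.log (2 / δ) :=
      Real.log_le_log two_pos (le_div_self two_pos.le hδ hδ₁)
    have hlog_two := Real.log_two_gt_d9
    exact CovMask.covMechanism_isMaskingMechanism hd hη hε.le hδ (by linarith) (by linarith)
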